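/- Let $H$ be an infinite-dimensional complex Hilbert space, and let $H\otimes H$ be the (completed) Hilbert space tensor product. Let $U$ be the unitary operator on $H\otimes H$ with $U(x\otimes y)=y\otimes x$, let $P_-=\tfrac12(1-U)$, let $H\wedge H=P_-(H\otimes H)$, and put $x\wedge y=\sqrt2\,P_-(x\otimes y)=\tfrac1{\sqrt2}(x\otimes y-y\otimes x)$. The Schmidt rank $\mathrm{SR}(\xi)\in\{0,1,2,\dots,\infty\}$ of $\xi\in H\otimes H$ is the least $l$ such that $\xi=\sum_{i=1}^l c_i\eta_i$ with $c_i\in\mathbb C$ and $\eta_i\in\{x\otimes y:\ \|x\|=\|y\|=1\}$, and $\infty$ if there is no such $l$. The Slater rank $\mathrm{SLR}(\xi)$ of $\xi\in H\wedge H$ is defined in the same way with $\eta_i\in\{x\wedge y:\ \|x\wedge y\|=1\}$. (Thus the zero vector has rank $0$.) 1. Every $\xi\in H\otimes H$ has a Schmidt decomposition: there are a sequence of numbers $\lambda_n\ge 0$ with $(\lambda_n)_{n\in\mathbb N}\in\ell^2(\mathbb N)$ and orthonormal systems $(e_n)_{n\in\mathbb N}$, $(f_n)_{n\in\mathbb N}$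 in $H$ such that $\xi=\sum_{n}\lambda_n\,e_n\otimes f_n$. 2. Every $\xi\in H\wedge H$ has a Slater decomposition: there are a sequence of numbers $\lambda_n\ge 0$ with $(\lambda_n)_{n\in\mathbb N}\in\ell^2(\mathbb N)$ and orthonormal systems $(e_n)_{n\in\mathbb N}$, $(f_n)_{n\in\mathbb N}$ in $H$ that are orthogonal to each other ($\langle e_m,f_n\rangle=0$ for all $m,n$) such that $\xi=\sum_{n}\lambda_n\,e_n\wedge f_n$. In both cases the nonzero coefficients are unique up to ordering: if $(\lambda_n)$ and $(\mu_n)$ are the coefficients of two Schmidt decompositions (respectively, two Slater decompositions) of the same vector, then there is a bijection $\sigma:\{n:\lambda_n\ne0\}\to\{n:\mu_n\ne0\}$ with $\mu_{\sigma(n)}=\lambda_n$ for all $n$ with $\lambda_n\neq 0$. Moreover, for every Schmidt (respectively, Slater) decomposition of $\xi$, the number in $\{0,1,2,\dots,\infty\}$ of its nonzero coefficients equals the Schmidt rank (respectively, the Slater rank) of $\xi$. -/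

import Mathlib

open scoped TensorProduct

namespace BipartiteHilbert

/-- The Hilbert space tensor product `H ⊗ H`: the completion of the algebraic tensor product
for the inner product with `⟪a ⊗ b, c ⊗ d⟫ = ⟪a, c⟫ * ⟪b, d⟫`. -/
abbrev HTensor (H : Type*) [NormedAddCommGroup H] [InnerProductSpace ℂ H] : Type _ :=
  UniformSpace.Completion (H ⊗[ℂ] H)

variable {H : Type*} [NormedAddCommGroup H] [InnerProductSpace ℂ H]

/-- The elementary tensor `x ⊗ y` in the Hilbert space tensor product. -/
noncomputable def tmul (x y : H) : HTensor H := ((x ⊗ₜ[ℂ] y : H ⊗[ℂ] H) : HTensor H)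

/-- The permutation operator of the transposition: the continuous linear operator on `H ⊗ H`
that extends `x ⊗ y ↦ y ⊗ x`. -/
noncomputable def swap : HTensor H →L[ℂ] HTensor H :=
  ((UniformSpace.Completion.toComplL (𝕜 := ℂ) (E := H ⊗[ℂ] H)).comp
    (TensorProduct.commIsometry ℂ H H).toContinuousLinearEquiv.toContinuousLinearMap).extend
      (UniformSpace.Completion.toComplL (𝕜 := ℂ) (E := H ⊗[ℂ] H))

theorem swap_coe (z : H ⊗[ℂ] H) :
    swap (z : HTensor H) = ((TensorProduct.comm ℂ H H z : H ⊗[ℂ] H) : HTensor H) :=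
  ContinuousLinearMap.extend_eq _ UniformSpace.Completion.denseRange_coe
    (UniformSpace.Completion.isUniformInducing_coe _) z

theorem swap_tmul (x y : H) : swap (tmul x y) = tmul y x := by
  simp [tmul, swap_coe]

/-- The projection onto the fermionic subspace, `(1 / 2!) ∑ π ∈ S₂, sign π • U_π`. -/
noncomputable def antisymmetrizer : HTensor H →L[ℂ] HTensor H :=
  (1 / 2 : ℂ) • (ContinuousLinearMap.id ℂ (HTensor H) - swap)

/-- The fermionic subspace `H ∧ H` of `H ⊗ H`, the range of the projection. -/
noncomputable def fermionic (H : Type*) [NormedAddCommGroup H] [InnerProductSpace ℂ H] :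
    Submodule ℂ (HTensor H) :=
  LinearMap.range (antisymmetrizer (H := H)).toLinearMap

/-- `x ∧ y = √(2!) P₋ (x ⊗ y)`, which equals `(x ⊗ y - y ⊗ x) / √2`. -/
noncomputable def wedge (x y : H) : HTensor H :=
  ((Real.sqrt 2 : ℝ) : ℂ) • antisymmetrizer (tmul x y)

/-- The unit product vectors `x ⊗ y`, `‖x‖ = ‖y‖ = 1`. -/
def unitProducts (H : Type*) [NormedAddCommGroup H] [InnerProductSpace ℂ H] : Set (HTensor H) :=
  {η | ∃ x y : H, ‖x‖ = 1 ∧ ‖y‖ = 1 ∧ η = tmul x y}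

/-- The vectors `x ∧ y` of norm one. -/
def unitWedges (H : Type*) [NormedAddCommGroup H] [InnerProductSpace ℂ H] : Set (HTensor H) :=
  {η | ∃ x y : H, ‖wedge x y‖ = 1 ∧ η = wedge x y}

/-- The least number `l` such that `ξ` is a linear combination of `l` vectors of `V`, and `⊤` if
`ξ` is not a finite linear combination of vectors of `V`. (The zero vector has rank `0`.) -/
noncomputable def rankIn (V : Set (HTensor H)) (ξ : HTensor H) : ℕ∞ :=
  sInf {L : ℕ∞ | ∃ l : ℕ, L = l ∧ ∃ (c : Fin l → ℂ) (η : Fin l → HTensor H),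
    (∀ i, η i ∈ V) ∧ ξ = ∑ i, c i • η i}

/-- The Schmidt rank. -/
noncomputable def schmidtRank (ξ : HTensor H) : ℕ∞ := rankIn (unitProducts H) ξ

/-- The Slater rank. -/
noncomputable def slaterRank (ξ : HTensor H) : ℕ∞ := rankIn (unitWedges H) ξ

/-- `ξ = ∑ λₙ eₙ ⊗ fₙ` is a Schmidt decomposition of `ξ`. -/
structure IsSchmidtDecomposition (ξ : HTensor H) (lam : ℕ → ℝ) (e f : ℕ → H) : Prop where
  nonneg : ∀ n, 0 ≤ lam n
  memℓp : Memℓp lam 2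
  orthonormal_left : Orthonormal ℂ e
  orthonormal_right : Orthonormal ℂ f
  hasSum : HasSum (fun n => (lam n : ℂ) • tmul (e n) (f n)) ξ

/-- `ξ = ∑ λₙ eₙ ∧ fₙ` is a Slater decomposition of `ξ`. -/
structure IsSlaterDecomposition (ξ : HTensor H) (lam : ℕ → ℝ) (e f : ℕ → H) : Prop where
  nonneg : ∀ n, 0 ≤ lam n
  memℓp : Memℓp lam 2
  orthonormal_left : Orthonormal ℂ e
  orthonormal_right : Orthonormal ℂ f
  orthogonal : ∀ m n, inner ℂ (e m) (f n) = 0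
  hasSum : HasSum (fun n => (lam n : ℂ) • wedge (e n) (f n)) ξ

/-- The nonzero terms of the two sequences agree up to order, with multiplicities. -/
def SameNonzeroTerms (lam mu : ℕ → ℝ) : Prop :=
  ∃ σ : {n : ℕ // lam n ≠ 0} ≃ {n : ℕ // mu n ≠ 0}, ∀ n, mu (σ n) = lam n

end BipartiteHilbert

/-! A vector `ξ` is encoded by the conjugate-linear operator `A = op ξ` with `⟪A x, y⟫ = ⟪ξ, x ⊗
y⟫`. It determines `ξ`, it is compact because `op` is norm-continuous and finite-rank on algebraic
tensors, and its adjoint is `op (swap ξ)`. So `opSq ξ = A* A` is a compact symmetric linear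
operator, and the claims become its spectral theory.

Uniqueness: in a Schmidt decomposition `A eₙ = λₙ fₙ`, so each `eₙ` is an eigenvector of `A* A` for
`λₙ²`. For `t > 0` the `eₙ` with `λₙ = t` span the whole eigenspace for `t²` (`span_fiber`), so
multiplicities depend on `ξ` alone. Rank: the range of `A` contains every `fₙ` with `λₙ ≠ 0`, and
lies in the span of the second factors of any finite expansion.

Existence: a maximal orthonormal set of eigenvectors of `A* A` with nonzero eigenvalue leaves only
the kernel of `A` in its orthogonal complement. Normalizing the images under `A` gives the other
system; infinite dimension allows padding to sequences.

For antisymmetric `ξ` the operator is skew, `A* A = -A²`, and nonzero eigenvectors pair up as `x`,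
`A x`. A Slater decomposition is thus a Schmidt family in which every coefficient, divided by `√2`,
occurs twice; uniqueness and rank follow by halving. -/

namespace BipartiteHilbert

/-! ### The conjugate-linear operator of a vector -/

section Operator

variable {H : Type*} [NormedAddCommGroup H] [InnerProductSpace ℂ H]

/-- The elementary tensor as a continuous bilinear map. -/
noncomputable def tmulL (H : Type*) [NormedAddCommGroup H] [InnerProductSpace ℂ H] :
    H →L[ℂ] H →L[ℂ] HTensor H :=
  (ContinuousLinearMap.compL ℂ H (H ⊗[ℂ] H) (HTensor H)
    (UniformSpace.Completion.toComplL (𝕜 := ℂ) (E := H ⊗[ℂ] H))).comp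
      (TensorProduct.mkL ℂ H H)

@[simp] theorem tmulL_apply (x y : H) : tmulL H x y = tmul x y := rfl

theorem tmul_neg_right (x y : H) : tmul x (-y) = -tmul x y := by
  simp [← tmulL_apply]

theorem inner_tmul_tmul (x y x' y' : H) :
    inner ℂ (tmul x y) (tmul x' y') = inner ℂ x x' * inner ℂ y y' := by
  simp [tmul, UniformSpace.Completion.inner_coe]

theorem norm_tmul (x y : H) : ‖tmul x y‖ = ‖x‖ * ‖y‖ := by
  simp [tmul]

/-- Vectors of the Hilbert tensor product are separated by elementary tensors. -/
theorem eq_zero_of_inner_tmul_eq_zero {ξ : HTensor H}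
    (h : ∀ x y : H, inner ℂ ξ (tmul x y) = 0) : ξ = 0 := by
  have key : ∀ η : HTensor H, inner ℂ ξ η = 0 := by
    intro η
    induction η using UniformSpace.Completion.induction_on with
    | hp => exact isClosed_eq (by fun_prop) continuous_const
    | ih z =>
      induction z using TensorProduct.induction_on with
      | zero => simp [UniformSpace.Completion.coe_zero]
      | tmul x y => exact h x y
      | add a b ha hb => rw [UniformSpace.Completion.coe_add, inner_add_right, ha, hb, add_zero]
  exact inner_self_eq_zero.1 (key ξ)

theorem inner_swap_tmul (ξ : HTensor H) (x y : H) :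
    inner ℂ (swap ξ) (tmul y x) = inner ℂ ξ (tmul x y) := by
  induction ξ using UniformSpace.Completion.induction_on with
  | hp => exact isClosed_eq (by fun_prop) (by fun_prop)
  | ih z =>
    induction z using TensorProduct.induction_on with
    | zero => simp [UniformSpace.Completion.coe_zero]
    | tmul a b =>
      change inner ℂ (swap (tmul a b)) _ = inner ℂ (tmul a b) _
      rw [swap_tmul, inner_tmul_tmul, inner_tmul_tmul, mul_comm]
    | add a b ha hb =>
      rw [UniformSpace.Completion.coe_add, map_add, inner_add_left, inner_add_left, ha, hb]

theorem swap_swap (ξ : HTensor H) : swap (swap ξ) = ξ := by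
  rw [← sub_eq_zero]
  refine eq_zero_of_inner_tmul_eq_zero fun x y => ?_
  rw [inner_sub_left, inner_swap_tmul, inner_swap_tmul, sub_self]

theorem swap_eq_neg_of_mem_fermionic {ξ : HTensor H} (h : ξ ∈ fermionic H) : swap ξ = -ξ := by
  obtain ⟨η, rfl⟩ := h
  simp [antisymmetrizer, swap_swap, ← smul_neg]

theorem wedge_eq (x y : H) :
    wedge x y = (((Real.sqrt 2)⁻¹ : ℝ) : ℂ) • (tmul x y - tmul y x) := by
  have h : ((Real.sqrt 2 : ℝ) : ℂ) * (1 / 2) = (((Real.sqrt 2)⁻¹ : ℝ) : ℂ) := by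
    have h2 : Real.sqrt 2 * (1 / 2) = (Real.sqrt 2)⁻¹ := by
      have := Real.mul_self_sqrt (show (0 : ℝ) ≤ 2 by norm_num)
      field_simp
      nlinarith
    rw [← h2]
    push_cast
    rfl
  simp only [wedge, antisymmetrizer, smul_smul, ← h, smul_apply,
    sub_apply, ContinuousLinearMap.id_apply, swap_tmul]

variable [CompleteSpace H]

/-- The conjugate-linear Hilbert–Schmidt operator of a vector of the Hilbert tensor product. -/
noncomputable def op (ξ : HTensor H) : H →L⋆[ℂ] H :=
  (InnerProductSpace.toDual ℂ H).symm.toContinuousLinearEquiv.toContinuousLinearMap.comp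
    ((ContinuousLinearMap.compL ℂ H (HTensor H) ℂ (innerSL ℂ ξ)).comp (tmulL H))

theorem inner_op (ξ : HTensor H) (x y : H) : inner ℂ (op ξ x) y = inner ℂ ξ (tmul x y) := by
  simp [op]

theorem op_sub (ξ η : HTensor H) : op (ξ - η) = op ξ - op η := by
  ext x
  refine ext_inner_right ℂ fun y => ?_
  simp [inner_op, inner_sub_left]

theorem op_add (ξ η : HTensor H) : op (ξ + η) = op ξ + op η := by
  ext x
  refine ext_inner_right ℂ fun y => ?_
  simp [inner_op, inner_add_left]

theorem op_neg (ξ : HTensor H) : op (-ξ) = -op ξ := by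
  ext x
  refine ext_inner_right ℂ fun y => ?_
  simp [inner_op]

theorem op_smul_apply (c : ℂ) (ξ : HTensor H) (x : H) : op (c • ξ) x = c • op ξ x := by
  refine ext_inner_right ℂ fun y => ?_
  simp [inner_op, inner_smul_left]

theorem op_sum_apply {ι : Type*} (s : Finset ι) (ξ : ι → HTensor H) (x : H) :
    op (∑ i ∈ s, ξ i) x = ∑ i ∈ s, op (ξ i) x := by
  refine ext_inner_right ℂ fun y => ?_
  simp [inner_op, sum_inner]

theorem op_tmul (a b x : H) : op (tmul a b) x = inner ℂ x a • b := by
  refine ext_inner_right ℂ fun y => ?_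
  simp [inner_op, inner_tmul_tmul, inner_smul_left]

theorem norm_op_le (ξ : HTensor H) : ‖op ξ‖ ≤ ‖ξ‖ := by
  refine ContinuousLinearMap.opNorm_le_bound _ (norm_nonneg _) fun x => ?_
  by_cases h : op ξ x = 0
  · rw [h, norm_zero]; positivity
  have h1 : ‖op ξ x‖ * ‖op ξ x‖ ≤ ‖ξ‖ * ‖x‖ * ‖op ξ x‖ := by
    have := norm_inner_le_norm (𝕜 := ℂ) ξ (tmul x (op ξ x))
    rwa [← inner_op, inner_self_eq_norm_sq_to_K, norm_pow, RCLike.norm_ofReal, abs_norm,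
      sq, norm_tmul, ← mul_assoc] at this
  exact le_of_mul_le_mul_right h1 (norm_pos_iff.2 h)

theorem continuous_op : Continuous (op (H := H)) := by
  refine (LipschitzWith.of_dist_le_mul (K := 1) fun ξ η => ?_).continuous
  rw [dist_eq_norm, dist_eq_norm, ← op_sub, NNReal.coe_one, one_mul]
  exact norm_op_le _

/-- Elementary tensors give rank-one operators, and compactness passes to sums and to norm limits.
-/
theorem isCompactOperator_op (ξ : HTensor H) : IsCompactOperator (op ξ) := by
  induction ξ using UniformSpace.Completion.induction_on with
  | hp => exact isClosed_setOfPred_isCompactOperator.preimage continuous_op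
  | ih z =>
    induction z using TensorProduct.induction_on with
    | zero =>
      have : op ((0 : H ⊗[ℂ] H) : HTensor H) = 0 := by
        ext x
        refine ext_inner_right ℂ fun y => ?_
        simp [inner_op, UniformSpace.Completion.coe_zero]
      rw [this]
      exact isCompactOperator_zero
    | tmul a b =>
      have h1 : IsCompactOperator (ContinuousLinearMap.toSpanSingleton ℂ b) :=
        isCompactOperator_of_locallyCompactSpace_rng _
      have h2 := h1.comp_clm (innerSLFlip ℂ a)
      have h3 : ⇑(op (tmul a b)) =
          ContinuousLinearMap.toSpanSingleton ℂ b ∘ innerSLFlip ℂ a := by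
        funext x
        simpa using! op_tmul a b x
      exact h3 ▸ h2
    | add a b ha hb =>
      rw [UniformSpace.Completion.coe_add, op_add]
      exact ha.add hb

/-- This identifies `op (swap ξ)` as the adjoint of `op ξ`, in the form appropriate to
conjugate-linear maps. -/
theorem inner_op_swap (ξ : HTensor H) (x y : H) :
    inner ℂ (op (swap ξ) x) y = inner ℂ (op ξ y) x := by
  rw [inner_op, inner_op, ← inner_swap_tmul ξ]

/-- The square of the absolute value of `op ξ`. -/
noncomputable def opSq (ξ : HTensor H) : H →L[ℂ] H := (op (swap ξ)).comp (op ξ)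

theorem opSq_apply (ξ : HTensor H) (x : H) : opSq ξ x = op (swap ξ) (op ξ x) := rfl

theorem inner_opSq (ξ : HTensor H) (x y : H) :
    inner ℂ (opSq ξ x) y = inner ℂ (op ξ y) (op ξ x) := by
  rw [opSq_apply, inner_op_swap]

theorem opSq_isSymmetric (ξ : HTensor H) : (opSq ξ : H →ₗ[ℂ] H).IsSymmetric := by
  intro x y
  change inner ℂ (opSq ξ x) y = inner ℂ x (opSq ξ y)
  rw [← inner_conj_symm x, inner_opSq, inner_opSq, inner_conj_symm]

theorem isCompactOperator_opSq (ξ : HTensor H) : IsCompactOperator (opSq ξ) :=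
  (isCompactOperator_op ξ).clm_comp (op (swap ξ))

theorem op_eq_zero_of_opSq_eq_zero {ξ : HTensor H} {x : H} (h : opSq ξ x = 0) : op ξ x = 0 := by
  have := inner_opSq ξ x x
  rw [h, inner_zero_left] at this
  exact inner_self_eq_zero.1 this.symm

end Operator

/-! ### Uniqueness of Schmidt coefficients and the Schmidt rank -/

section Decomposition

variable {H : Type*} [NormedAddCommGroup H] [InnerProductSpace ℂ H]

/-- A Schmidt decomposition indexed by an arbitrary type. -/
structure IsSchmidtFamily {ι : Type*} (ξ : HTensor H) (lam : ι → ℝ) (e f : ι → H) : Prop where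
  nonneg : ∀ n, 0 ≤ lam n
  orthonormal_left : Orthonormal ℂ e
  orthonormal_right : Orthonormal ℂ f
  hasSum : HasSum (fun n => (lam n : ℂ) • tmul (e n) (f n)) ξ

theorem IsSchmidtDecomposition.isSchmidtFamily {ξ : HTensor H} {lam : ℕ → ℝ} {e f : ℕ → H}
    (h : IsSchmidtDecomposition ξ lam e f) : IsSchmidtFamily ξ lam e f :=
  ⟨h.nonneg, h.orthonormal_left, h.orthonormal_right, h.hasSum⟩

variable {ι : Type*} {ξ : HTensor H} {lam : ι → ℝ} {e f : ι → H}

theorem IsSchmidtFamily.swap (h : IsSchmidtFamily ξ lam e f) :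
    IsSchmidtFamily (swap ξ) lam f e := by
  refine ⟨h.nonneg, h.orthonormal_right, h.orthonormal_left, ?_⟩
  simpa only [map_smul, swap_tmul] using h.hasSum.mapL BipartiteHilbert.swap

theorem rankIn_le_encard {V : Set (HTensor H)} {lam : ℕ → ℝ} {η : ℕ → HTensor H}
    (hη : ∀ n, η n ∈ V) (hs : HasSum (fun n => (lam n : ℂ) • η n) ξ) :
    rankIn V ξ ≤ {n | lam n ≠ 0}.encard := by
  rcases Set.finite_or_infinite {n | lam n ≠ 0} with hfin | hinf
  · rw [hfin.encard_eq_coe_toFinset_card]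
    set s := hfin.toFinset
    refine sInf_le ⟨s.card, rfl, fun i => (lam (s.equivFin.symm i) : ℂ),
      fun i => η (s.equivFin.symm i), fun i => hη _, ?_⟩
    rw [Equiv.sum_comp s.equivFin.symm (fun n : s => (lam n : ℂ) • η n),
      Finset.sum_coe_sort s (fun n => (lam n : ℂ) • η n)]
    refine hs.unique (hasSum_sum_of_ne_finset_zero fun n hn => ?_)
    have : lam n = 0 := by simpa [s] using hn
    simp [this]
  · rw [hinf.encard_eq]
    exact le_top

variable [CompleteSpace H]

theorem hasSum_inner_op {c : ι → ℂ} (h : HasSum (fun n => c n • tmul (e n) (f n)) ξ) (x y : H) :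
    HasSum (fun n => c n * (inner ℂ x (e n) * inner ℂ y (f n))) (inner ℂ y (op ξ x)) := by
  have h1 := h.mapL (innerSL ℂ (tmul x y))
  rw [← inner_conj_symm, inner_op, inner_conj_symm]
  simpa [inner_smul_right, inner_tmul_tmul] using h1

theorem op_left_of_hasSum {c : ι → ℂ} (he : Orthonormal ℂ e)
    (h : HasSum (fun n => c n • tmul (e n) (f n)) ξ) (j : ι) : op ξ (e j) = c j • f j := by
  refine ext_inner_left ℂ fun y => ?_
  have h1 := hasSum_inner_op h (e j) y
  have h2 := hasSum_single (f := fun n => c n * (inner ℂ (e j) (e n) * inner ℂ y (f n))) j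
    (fun n hn => by simp [he.inner_eq_zero hn.symm])
  rw [h1.unique h2, inner_smul_right, inner_self_eq_norm_sq_to_K, he.norm_eq_one]
  simp

theorem op_eq_zero_of_hasSum {c : ι → ℂ} (h : HasSum (fun n => c n • tmul (e n) (f n)) ξ) {x : H}
    (hx : ∀ n, inner ℂ (e n) x = 0) : op ξ x = 0 := by
  refine ext_inner_left ℂ fun y => ?_
  have h1 := hasSum_inner_op h x y
  simp only [inner_eq_zero_symm.1 (hx _), zero_mul, mul_zero] at h1
  rw [h1.unique hasSum_zero, inner_zero_right]

theorem IsSchmidtFamily.op_left (h : IsSchmidtFamily ξ lam e f) (j : ι) :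
    op ξ (e j) = (lam j : ℂ) • f j :=
  op_left_of_hasSum h.orthonormal_left h.hasSum j

theorem IsSchmidtFamily.opSq_left (h : IsSchmidtFamily ξ lam e f) (j : ι) :
    opSq ξ (e j) = ((lam j ^ 2 : ℝ) : ℂ) • e j := by
  rw [opSq_apply, h.op_left, map_smulₛₗ, h.swap.op_left, smul_smul]
  simp [sq]

/-- The eigenspace of `opSq ξ` for the eigenvalue `t ^ 2`. -/
noncomputable def singularSpace (ξ : HTensor H) (t : ℝ) : Submodule ℂ H :=
  Module.End.eigenspace (opSq ξ : H →ₗ[ℂ] H) ((t ^ 2 : ℝ) : ℂ)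

theorem mem_singularSpace {t : ℝ} {x : H} :
    x ∈ singularSpace ξ t ↔ opSq ξ x = ((t ^ 2 : ℝ) : ℂ) • x :=
  Module.End.mem_eigenspace_iff

theorem finiteDimensional_singularSpace (ξ : HTensor H) {t : ℝ} (ht : 0 < t) :
    FiniteDimensional ℂ (singularSpace ξ t) :=
  ContinuousLinearMap.finite_dimensional_eigenspace (isCompactOperator_opSq ξ) _
    (by exact_mod_cast (pow_pos ht 2).ne')

theorem IsSchmidtFamily.linearIndependent_fiber (h : IsSchmidtFamily ξ lam e f) (t : ℝ) :
    LinearIndependent ℂ (fun i : {i // lam i = t} =>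
      (⟨e i, mem_singularSpace.2 (by rw [h.opSq_left, i.2])⟩ : singularSpace ξ t)) := by
  refine LinearIndependent.of_comp (singularSpace ξ t).subtype ?_
  exact (h.orthonormal_left.comp _ Subtype.val_injective).linearIndependent

theorem IsSchmidtFamily.finite_fiber (h : IsSchmidtFamily ξ lam e f) {t : ℝ} (ht : 0 < t) :
    Finite {i // lam i = t} := by
  have := finiteDimensional_singularSpace ξ ht
  exact (h.linearIndependent_fiber t).finite

/-- Remove from an eigenvector its projection to the span. The remainder is orthogonal to every `e
n`, hence killed by `op ξ`; being an eigenvector for `t ^ 2 ≠ 0` unless zero, it vanishes. -/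
theorem IsSchmidtFamily.span_fiber (h : IsSchmidtFamily ξ lam e f) {t : ℝ} (ht : 0 < t) :
    singularSpace ξ t = Submodule.span ℂ (Set.range fun i : {i // lam i = t} => e i) := by
  have := h.finite_fiber ht
  have := Fintype.ofFinite {i // lam i = t}
  apply le_antisymm
  · intro x hx
    set p := ∑ i : {i // lam i = t}, inner ℂ (e i) x • e i with hp
    have hpmem : p ∈ singularSpace ξ t := Submodule.sum_mem _ fun i _ =>
      Submodule.smul_mem _ _ (mem_singularSpace.2 (by rw [h.opSq_left, i.2]))
    have hsub := mem_singularSpace.1 (Submodule.sub_mem _ hx hpmem)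
    have horth : ∀ n, inner ℂ (e n) (x - p) = 0 := by
      intro n
      by_cases hn : lam n = t
      · rw [inner_sub_right, hp, inner_sum, Finset.sum_eq_single ⟨n, hn⟩]
        · rw [inner_smul_right, inner_self_eq_norm_sq_to_K, h.orthonormal_left.norm_eq_one]
          simp
        · intro i _ hi
          rw [inner_smul_right, h.orthonormal_left.inner_eq_zero, mul_zero]
          exact fun h' => hi (Subtype.ext h'.symm)
        · simp
      -- Eigenvectors of a symmetric operator for different eigenvalues are orthogonal;
      -- nonnegativity turns `lam n ≠ t` into `lam n ^ 2 ≠ t ^ 2`.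
      · have h1 := opSq_isSymmetric ξ (e n) (x - p)
        change inner ℂ (opSq ξ (e n)) (x - p) = inner ℂ (e n) (opSq ξ (x - p)) at h1
        rw [h.opSq_left, hsub, inner_smul_left, inner_smul_right, Complex.conj_ofReal,
          ← sub_eq_zero, ← sub_mul] at h1
        refine (mul_eq_zero.1 h1).resolve_left fun h2 => hn ?_
        rw [sub_eq_zero] at h2
        exact (sq_eq_sq₀ (h.nonneg n) ht.le).1 (by exact_mod_cast h2)
    have hz : x - p = 0 := by
      rw [opSq_apply, op_eq_zero_of_hasSum h.hasSum horth, map_zero] at hsub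
      refine (smul_eq_zero.1 hsub.symm).resolve_left ?_
      exact_mod_cast (pow_pos ht 2).ne'
    rw [sub_eq_zero.1 hz]
    exact Submodule.sum_mem _ fun i _ =>
      Submodule.smul_mem _ _ (Submodule.subset_span ⟨i, rfl⟩)
  · rw [Submodule.span_le]
    rintro _ ⟨i, rfl⟩
    exact mem_singularSpace.2 (by rw [h.opSq_left, i.2])

theorem IsSchmidtFamily.card_fiber (h : IsSchmidtFamily ξ lam e f) {t : ℝ} (ht : 0 < t) :
    Nat.card {i // lam i = t} = Module.finrank ℂ (singularSpace ξ t) := by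
  have := h.finite_fiber ht
  have := Fintype.ofFinite {i // lam i = t}
  rw [h.span_fiber ht, Nat.card_eq_fintype_card, finrank_span_eq_card]
  exact (h.orthonormal_left.comp _ Subtype.val_injective).linearIndependent

/-- Bijections between level sets are glued along the common value. Finiteness is essential, since
`Nat.card` is `0` on infinite types. -/
theorem sameNonzeroTerms_of_card_fiber {lam mu : ℕ → ℝ} (hlam : ∀ n, 0 ≤ lam n)
    (hmu : ∀ n, 0 ≤ mu n) (hf : ∀ t, 0 < t → Finite {n // lam n = t})
    (hf' : ∀ t, 0 < t → Finite {n // mu n = t})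
    (hc : ∀ t, 0 < t → Nat.card {n // lam n = t} = Nat.card {n // mu n = t}) :
    SameNonzeroTerms lam mu := by
  have key : ∀ t : ℝ, Nonempty ({a : {n // lam n ≠ 0} // lam a = t} ≃
      {b : {n // mu n ≠ 0} // mu b = t}) := by
    intro t
    rcases lt_or_ge 0 t with ht | ht
    · have := hf t ht
      have := hf' t ht
      have aux : ∀ nu : ℕ → ℝ, Nonempty ({a : {n // nu n ≠ 0} // nu a = t} ≃ {n // nu n = t}) :=
        fun nu => ⟨⟨fun a => ⟨a.1.1, a.2⟩, fun n => ⟨⟨n.1, n.2.trans_ne ht.ne'⟩, n.2⟩,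
          fun _ => rfl, fun _ => rfl⟩⟩
      obtain ⟨a⟩ := aux lam
      obtain ⟨b⟩ := aux mu
      exact ⟨(a.trans (Finite.card_eq.1 (hc t ht)).some).trans b.symm⟩
    · have aux : ∀ nu : ℕ → ℝ, (∀ n, 0 ≤ nu n) → IsEmpty {a : {n // nu n ≠ 0} // nu a = t} :=
        fun nu hnu => ⟨fun a => a.1.2 (le_antisymm (a.2.trans_le ht) (hnu _))⟩
      have := aux lam hlam
      have := aux mu hmu
      exact ⟨Equiv.equivOfIsEmpty _ _⟩
  exact ⟨Equiv.ofFiberEquiv (f := fun a : {n // lam n ≠ 0} => lam a)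
    (g := fun b : {n // mu n ≠ 0} => mu b) fun t => (key t).some,
    fun n => Equiv.ofFiberEquiv_map (f := fun a : {n // lam n ≠ 0} => lam a)
      (g := fun b : {n // mu n ≠ 0} => mu b) _ n⟩

theorem IsSchmidtDecomposition.sameNonzeroTerms {ξ : HTensor H} {lam mu : ℕ → ℝ}
    {e f e' f' : ℕ → H} (h : IsSchmidtDecomposition ξ lam e f)
    (h' : IsSchmidtDecomposition ξ mu e' f') : SameNonzeroTerms lam mu :=
  sameNonzeroTerms_of_card_fiber h.nonneg h'.nonneg (fun _ ht => h.isSchmidtFamily.finite_fiber ht)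
    (fun _ ht => h'.isSchmidtFamily.finite_fiber ht) fun _ ht =>
      (h.isSchmidtFamily.card_fiber ht).trans (h'.isSchmidtFamily.card_fiber ht).symm

/-- The number of nonzero coefficients is at most the dimension of a space containing the
range of `op ξ`. -/
theorem IsSchmidtFamily.encard_le (h : IsSchmidtFamily ξ lam e f) (W : Submodule ℂ H)
    [FiniteDimensional ℂ W] (hW : ∀ x, op ξ x ∈ W) :
    {i | lam i ≠ 0}.encard ≤ Module.finrank ℂ W := by
  have hmem : ∀ i : {i | lam i ≠ 0}, f i ∈ W := by
    intro i
    have h1 := W.smul_mem ((lam i : ℂ)⁻¹) (hW (e i))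
    rwa [h.op_left, smul_smul, inv_mul_cancel₀ (by exact_mod_cast i.2), one_smul] at h1
  have hli : LinearIndependent ℂ (fun i : {i | lam i ≠ 0} => (⟨f i, hmem i⟩ : W)) := by
    refine LinearIndependent.of_comp W.subtype ?_
    exact (h.orthonormal_right.comp _ Subtype.val_injective).linearIndependent
  have := hli.finite
  have := Fintype.ofFinite {i | lam i ≠ 0}
  rw [Set.encard, ENat.card_eq_coe_fintype_card]
  exact_mod_cast hli.fintype_card_le_finrank

theorem IsSchmidtDecomposition.encard_eq {ξ : HTensor H} {lam : ℕ → ℝ} {e f : ℕ → H}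
    (h : IsSchmidtDecomposition ξ lam e f) : {n | lam n ≠ 0}.encard = schmidtRank ξ := by
  apply le_antisymm
  · refine le_sInf ?_
    rintro _ ⟨l, rfl, c, η, hη, rfl⟩
    choose x y _ _ hxy using hη
    have := FiniteDimensional.span_of_finite ℂ (Set.finite_range y)
    refine (h.isSchmidtFamily.encard_le (Submodule.span ℂ (Set.range y)) fun z => ?_).trans ?_
    · rw [op_sum_apply]
      refine Submodule.sum_mem _ fun i _ => ?_
      rw [op_smul_apply, hxy, op_tmul]
      exact Submodule.smul_mem _ _ (Submodule.smul_mem _ _ (Submodule.subset_span ⟨i, rfl⟩))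
    · have := finrank_range_le_card (R := ℂ) y
      rw [Fintype.card_fin] at this
      exact_mod_cast this
  · exact rankIn_le_encard (fun n => ⟨e n, f n, h.orthonormal_left.norm_eq_one n,
      h.orthonormal_right.norm_eq_one n, rfl⟩) h.hasSum

end Decomposition

/-! ### Slater decompositions as doubled Schmidt families -/

section Slater

variable {H : Type*} [NormedAddCommGroup H] [InnerProductSpace ℂ H]

theorem orthonormal_sumElim {E ι κ : Type*} [NormedAddCommGroup E] [InnerProductSpace ℂ E]
    {u : ι → E} {v : κ → E} (hu : Orthonormal ℂ u) (hv : Orthonormal ℂ v)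
    (huv : ∀ i k, inner ℂ (u i) (v k) = 0) : Orthonormal ℂ (Sum.elim u v) := by
  refine ⟨?_, ?_⟩
  · rintro (i | k)
    · exact hu.1 i
    · exact hv.1 k
  · rintro (i | k) (j | l) h
    · exact hu.2 fun h' => h (congrArg _ h')
    · exact huv i l
    · exact inner_eq_zero_symm.1 (huv j k)
    · exact hv.2 fun h' => h (congrArg _ h')

theorem orthonormal_tmul {ι : Type*} {e f : ι → H} (he : Orthonormal ℂ e)
    (hf : ∀ i, ‖f i‖ = 1) : Orthonormal ℂ fun i => tmul (e i) (f i) :=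
  ⟨fun i => by rw [norm_tmul, he.1, hf, one_mul],
    fun i j hij => (inner_tmul_tmul _ _ _ _).trans (by rw [he.2 hij, zero_mul])⟩

theorem summable_smul_of_orthonormal {E ι : Type*} [NormedAddCommGroup E] [InnerProductSpace ℂ E]
    [CompleteSpace E] {v : ι → E} (hv : Orthonormal ℂ v) {c : ι → ℂ}
    (hc : Summable fun i => ‖c i‖ ^ 2) : Summable fun i => c i • v i := by
  have h := hv.orthogonalFamily.summable_iff_norm_sq_summable c
  simpa using h.2 hc

theorem norm_wedge {x y : H} (hx : ‖x‖ = 1) (hy : ‖y‖ = 1) (hxy : inner ℂ x y = 0) :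
    ‖wedge x y‖ = 1 := by
  have hyx := inner_eq_zero_symm.1 hxy
  have h : ‖tmul x y - tmul y x‖ ^ 2 = 2 := by
    rw [norm_sub_sq (𝕜 := ℂ), inner_tmul_tmul, hxy, norm_tmul, norm_tmul, hx, hy]
    norm_num
  rw [wedge_eq, norm_smul, Complex.norm_real, ← Real.sqrt_sq (norm_nonneg (_ - _)), h,
    Real.norm_of_nonneg (by positivity), inv_mul_cancel₀ (by positivity)]

theorem summable_sq_of_memℓp {ι : Type*} {lam : ι → ℝ} (h : Memℓp lam 2) :
    Summable fun i => lam i ^ 2 := by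
  simpa using h.summable (by norm_num)

/-- `√2 (e ∧ f) = e ⊗ f + f ⊗ (-e)`: putting the sign into the second system keeps the coefficients
nonnegative. -/
theorem IsSlaterDecomposition.isSchmidtFamily {ξ : HTensor H} {lam : ℕ → ℝ} {e f : ℕ → H}
    (h : IsSlaterDecomposition ξ lam e f) :
    IsSchmidtFamily ξ (Sum.elim (fun n => lam n * (Real.sqrt 2)⁻¹)
      (fun n => lam n * (Real.sqrt 2)⁻¹)) (Sum.elim e f) (Sum.elim f (-e)) := by
  have hneg : Orthonormal ℂ (-e) :=
    ⟨fun i => by simpa using h.orthonormal_left.1 i,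
      fun i j hij => by simpa using h.orthonormal_left.2 hij⟩
  -- Square summability makes the two halves converge separately, so the sum of wedges can be split
  -- over `ℕ ⊕ ℕ`.
  have hs : Summable fun n => ‖((lam n * (Real.sqrt 2)⁻¹ : ℝ) : ℂ)‖ ^ 2 := by
    simpa [mul_pow] using (summable_sq_of_memℓp h.memℓp).mul_right (2⁻¹)
  have h1 := summable_smul_of_orthonormal
    (orthonormal_tmul h.orthonormal_left h.orthonormal_right.1) hs
  have h2 := summable_smul_of_orthonormal (orthonormal_tmul h.orthonormal_right hneg.1) hs
  refine ⟨?_, orthonormal_sumElim h.orthonormal_left h.orthonormal_right h.orthogonal,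
    orthonormal_sumElim h.orthonormal_right hneg fun i k => ?_, ?_⟩
  · rintro (n | n) <;> exact mul_nonneg (h.nonneg n) (by positivity)
  · rw [Pi.neg_apply, inner_neg_right, inner_eq_zero_symm.1 (h.orthogonal k i), neg_zero]
  · have h3 := h1.hasSum.add h2.hasSum
    have h4 : (fun n => ((lam n * (Real.sqrt 2)⁻¹ : ℝ) : ℂ) • tmul (e n) (f n) +
        ((lam n * (Real.sqrt 2)⁻¹ : ℝ) : ℂ) • tmul (f n) ((-e) n)) =
        fun n => (lam n : ℂ) • wedge (e n) (f n) := by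
      funext n
      rw [wedge_eq, Pi.neg_apply, tmul_neg_right, ← smul_add, ← sub_eq_add_neg, smul_smul,
        Complex.ofReal_mul]
    rw [h4] at h3
    rw [h.hasSum.unique h3]
    exact HasSum.sum h1.hasSum h2.hasSum

theorem encard_sumElim {α β : Type*} (s : Set α) (t : Set β) :
    {i : α ⊕ β | Sum.elim (· ∈ s) (· ∈ t) i}.encard = s.encard + t.encard := by
  have h : {i : α ⊕ β | Sum.elim (· ∈ s) (· ∈ t) i} = Sum.inl '' s ∪ Sum.inr '' t := by
    ext (i | i) <;> simp
  rw [h, Set.encard_union_eq (by simp [Set.disjoint_left]), Sum.inl_injective.encard_image,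
    Sum.inr_injective.encard_image]

variable [CompleteSpace H]

theorem IsSlaterDecomposition.finite_fiber {ξ : HTensor H} {lam : ℕ → ℝ} {e f : ℕ → H}
    (h : IsSlaterDecomposition ξ lam e f) {t : ℝ} (ht : 0 < t) : Finite {n // lam n = t} := by
  have := h.isSchmidtFamily.finite_fiber (t := t * (Real.sqrt 2)⁻¹) (by positivity)
  refine Finite.of_injective (fun n : {n // lam n = t} => (⟨Sum.inl n, by simp [n.2]⟩ :
    {i // Sum.elim (fun n => lam n * (Real.sqrt 2)⁻¹)
      (fun n => lam n * (Real.sqrt 2)⁻¹) i = t * (Real.sqrt 2)⁻¹})) fun a b hab => ?_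
  exact Subtype.ext (Sum.inl_injective (congrArg Subtype.val hab))

theorem IsSlaterDecomposition.card_fiber {ξ : HTensor H} {lam : ℕ → ℝ} {e f : ℕ → H}
    (h : IsSlaterDecomposition ξ lam e f) {t : ℝ} (ht : 0 < t) :
    2 * Nat.card {n // lam n = t} =
      Module.finrank ℂ (singularSpace ξ (t * (Real.sqrt 2)⁻¹)) := by
  have := h.finite_fiber ht
  rw [← h.isSchmidtFamily.card_fiber (by positivity), two_mul, ← Nat.card_sum]
  refine Nat.card_congr (Equiv.trans (Equiv.sumCongr (Equiv.subtypeEquivRight fun n => ?_)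
    (Equiv.subtypeEquivRight fun n => ?_)) (Equiv.subtypeSum).symm)
  all_goals
    have h2 : (Real.sqrt 2)⁻¹ ≠ 0 := by positivity
    simp [h2]

theorem IsSlaterDecomposition.sameNonzeroTerms {ξ : HTensor H} {lam mu : ℕ → ℝ}
    {e f e' f' : ℕ → H} (h : IsSlaterDecomposition ξ lam e f)
    (h' : IsSlaterDecomposition ξ mu e' f') : SameNonzeroTerms lam mu :=
  sameNonzeroTerms_of_card_fiber h.nonneg h'.nonneg (fun _ ht => h.finite_fiber ht)
    (fun _ ht => h'.finite_fiber ht) fun _ ht =>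
      Nat.eq_of_mul_eq_mul_left two_pos ((h.card_fiber ht).trans (h'.card_fiber ht).symm)

/-- A combination of `l` wedges has operator range of dimension at most `2 * l`, while the doubled
family has twice as many nonzero coefficients. -/
theorem IsSlaterDecomposition.encard_eq {ξ : HTensor H} {lam : ℕ → ℝ} {e f : ℕ → H}
    (h : IsSlaterDecomposition ξ lam e f) : {n | lam n ≠ 0}.encard = slaterRank ξ := by
  apply le_antisymm
  · refine le_sInf ?_
    rintro _ ⟨l, rfl, c, η, hη, rfl⟩
    choose x y _ hxy using hη
    have hfin := FiniteDimensional.span_of_finite ℂ (Set.finite_range (Sum.elim x y))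
    have h1 := h.isSchmidtFamily.encard_le (Submodule.span ℂ (Set.range (Sum.elim x y)))
      fun z => by
        rw [op_sum_apply]
        refine Submodule.sum_mem _ fun i _ => ?_
        rw [op_smul_apply, hxy, wedge_eq, op_smul_apply, op_sub, sub_apply, op_tmul, op_tmul]
        exact Submodule.smul_mem _ _ (Submodule.smul_mem _ _ (Submodule.sub_mem _
          (Submodule.smul_mem _ _ (Submodule.subset_span ⟨Sum.inr i, rfl⟩))
          (Submodule.smul_mem _ _ (Submodule.subset_span ⟨Sum.inl i, rfl⟩))))
    have h2 := finrank_range_le_card (R := ℂ) (Sum.elim x y)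
    rw [Fintype.card_sum, Fintype.card_fin] at h2
    have h3 := encard_sumElim {n | lam n ≠ 0} {n | lam n ≠ 0}
    have h4 : {i : ℕ ⊕ ℕ | Sum.elim (fun n => lam n * (Real.sqrt 2)⁻¹)
        (fun n => lam n * (Real.sqrt 2)⁻¹) i ≠ 0} =
        {i : ℕ ⊕ ℕ | Sum.elim (· ∈ {n | lam n ≠ 0}) (· ∈ {n | lam n ≠ 0}) i} := by
      ext (i | i) <;> simp
    rw [h4, h3] at h1
    have h5 : {n | lam n ≠ 0}.encard + {n | lam n ≠ 0}.encard ≤ ((l + l : ℕ) : ℕ∞) :=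
      h1.trans (by exact_mod_cast h2)
    generalize {n | lam n ≠ 0}.encard = a at h5 ⊢
    induction a using ENat.recTopCoe with
    | top => simp at h5
    | coe a =>
      norm_cast at h5 ⊢
      omega
  · exact rankIn_le_encard (fun n => ⟨e n, f n, norm_wedge (h.orthonormal_left.norm_eq_one n)
      (h.orthonormal_right.norm_eq_one n) (h.orthogonal n n), rfl⟩) h.hasSum

end Slater

/-! ### Maximal systems of eigenvectors -/

section Existence

theorem exists_maximal_pairwise {α : Type*} (P : α → Prop) (R : α → α → Prop) :
    ∃ S : Set α, (∀ x ∈ S, P x) ∧ S.Pairwise R ∧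
      ∀ y, P y → (∀ x ∈ S, R x y ∧ R y x) → y ∈ S := by
  obtain ⟨S, hS⟩ := zorn_subset {S : Set α | (∀ x ∈ S, P x) ∧ S.Pairwise R} fun c hc hchain => by
    refine ⟨⋃₀ c, ⟨?_, ?_⟩, fun s hs => Set.subset_sUnion_of_mem hs⟩
    · rintro x ⟨s, hs, hx⟩
      exact (hc hs).1 x hx
    · exact (Set.pairwise_sUnion hchain.directedOn).2 fun s hs => (hc hs).2
  refine ⟨S, hS.prop.1, hS.prop.2, fun y hy hR => ?_⟩
  refine hS.le_of_ge (y := insert y S) ⟨?_, ?_⟩ (Set.subset_insert y S) (Set.mem_insert y S)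
  · rintro x (rfl | hx)
    · exact hy
    · exact hS.prop.1 x hx
  · exact hS.prop.2.insert fun x hx _ => ⟨(hR x hx).2, (hR x hx).1⟩

variable {H : Type*} [NormedAddCommGroup H] [InnerProductSpace ℂ H]

theorem mem_orthogonal_span_iff {s : Set H} {z : H} :
    z ∈ (Submodule.span ℂ s)ᗮ ↔ ∀ x ∈ s, inner ℂ x z = 0 := by
  refine ⟨fun h x hx => h x (Submodule.subset_span hx), fun h x hx => ?_⟩
  induction hx using Submodule.span_induction with
  | mem x hx => exact h x hx
  | zero => exact inner_zero_left _
  | add x y _ _ hx hy => rw [inner_add_left, hx, hy, add_zero]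
  | smul c x _ hx => rw [inner_smul_left, hx, mul_zero]

variable [CompleteSpace H]

/-- The restriction to `M` is a nonzero compact symmetric operator, so it has a nonzero eigenvalue.
This is what contradicts maximality in both existence proofs. -/
theorem exists_eigenvector_mem {K : H →L[ℂ] H} (hK : IsCompactOperator K)
    (hsymm : (K : H →ₗ[ℂ] H).IsSymmetric) (M : Submodule ℂ H) (hMc : IsClosed (M : Set H))
    (hM : ∀ x ∈ M, K x ∈ M) {x : H} (hx : x ∈ M) (hKx : K x ≠ 0) :
    ∃ y ∈ M, ‖y‖ = 1 ∧ K y ≠ 0 ∧ ∃ c : ℂ, K y = c • y := by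
  have : CompleteSpace M := hMc.completeSpace_coe
  let T : M →L[ℂ] M := K.restrict hM
  have hT : IsCompactOperator T := hK.restrict' hM
  have hTs : (T : M →ₗ[ℂ] M).IsSymmetric := hsymm.restrict_invariant hM
  have hT0 : T ≠ 0 := fun h => hKx <| by
    have h1 : T ⟨x, hx⟩ = 0 := by rw [h, zero_apply]
    exact congrArg Subtype.val h1
  have h1 := mt (ContinuousLinearMap.eq_zero_of_forall_hasEigenvalue_eq_zero hT hTs).1 hT0
  push Not at h1
  obtain ⟨c, hc, hc0⟩ := h1
  obtain ⟨y, hy⟩ := hc.exists_hasEigenvector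
  have hy0 : (y : H) ≠ 0 := fun h => hy.2 (Subtype.ext h)
  have hyc : K y = c • (y : H) := congrArg Subtype.val hy.apply_eq_smul
  have hn : ((‖(y : H)‖⁻¹ : ℝ) : ℂ) ≠ 0 := by
    exact_mod_cast inv_ne_zero (norm_ne_zero_iff.2 hy0)
  refine ⟨((‖(y : H)‖⁻¹ : ℝ) : ℂ) • (y : H), M.smul_mem _ y.2, ?_, ?_, c, ?_⟩
  · rw [norm_smul, Complex.norm_real, norm_inv, norm_norm,
      inv_mul_cancel₀ (norm_ne_zero_iff.2 hy0)]
  · rw [map_smul, hyc]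
    exact smul_ne_zero hn (smul_ne_zero hc0 hy0)
  · rw [map_smul, hyc, smul_comm]

theorem eq_of_op_eq {ξ η : HTensor H} (h : op ξ = op η) : ξ = η := by
  rw [← sub_eq_zero]
  refine eq_zero_of_inner_tmul_eq_zero fun x y => ?_
  rw [← inner_op, op_sub, h, sub_self, zero_apply, inner_zero_left]

theorem op_eq_of_orthonormal {ι : Type*} {e : ι → H} {ξ η : HTensor H}
    (he : ∀ i, op ξ (e i) = op η (e i))
    (hξ : ∀ x, (∀ i, inner ℂ (e i) x = 0) → op ξ x = op η x) : op ξ = op η := by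
  let N : Submodule ℂ H := (op ξ - op η : H →L⋆[ℂ] H).toLinearMap.ker
  have hN : ∀ x, x ∈ N ↔ op ξ x = op η x := fun x => by
    rw [← sub_eq_zero]
    rfl
  let V := (Submodule.span ℂ (Set.range e)).topologicalClosure
  have hV : V ≤ N := by
    refine Submodule.topologicalClosure_minimal _ ?_ (ContinuousLinearMap.isClosed_ker _)
    rw [Submodule.span_le]
    rintro _ ⟨i, rfl⟩
    exact (hN _).2 (he i)
  have hV' : Vᗮ ≤ N := fun x hx => (hN x).2 <| hξ x fun i =>
    hx _ (Submodule.le_topologicalClosure _ (Submodule.subset_span ⟨i, rfl⟩))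
  have hc : CompleteSpace V := (Submodule.isClosed_topologicalClosure _).completeSpace_coe
  have htop : N = ⊤ := by
    rw [eq_top_iff, ← Submodule.sup_orthogonal_of_hasOrthogonalProjection (K := V)]
    exact sup_le hV hV'
  ext x
  exact (hN x).1 (htop ▸ Submodule.mem_top)

/-- The normalized image of a vector under `op ξ`. -/
noncomputable def opUnit (ξ : HTensor H) (x : H) : H :=
  ((‖op ξ x‖⁻¹ : ℝ) : ℂ) • op ξ x

theorem norm_opUnit {ξ : HTensor H} {x : H} (h : op ξ x ≠ 0) : ‖opUnit ξ x‖ = 1 := by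
  rw [opUnit, norm_smul, Complex.norm_real, norm_inv, norm_norm,
    inv_mul_cancel₀ (norm_ne_zero_iff.2 h)]

theorem norm_smul_opUnit {ξ : HTensor H} {x : H} (h : op ξ x ≠ 0) :
    ((‖op ξ x‖ : ℝ) : ℂ) • opUnit ξ x = op ξ x := by
  rw [opUnit, smul_smul, ← Complex.ofReal_mul, mul_inv_cancel₀ (norm_ne_zero_iff.2 h),
    Complex.ofReal_one, one_smul]

/-- The coefficients are, in modulus, inner products of `ξ` with an orthonormal family, so Bessel
gives summability. The sum and `ξ` have operators agreeing on the `e i` and on their orthogonal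
complement, hence are equal. -/
theorem summable_and_hasSum_of_orthonormal {ι : Type*} {e : ι → H} {ξ : HTensor H}
    (he : Orthonormal ℂ e) (h0 : ∀ i, op ξ (e i) ≠ 0)
    (hξ : ∀ x, (∀ i, inner ℂ (e i) x = 0) → op ξ x = 0) :
    (Summable fun i => ‖op ξ (e i)‖ ^ 2) ∧
      HasSum (fun i => ((‖op ξ (e i)‖ : ℝ) : ℂ) • tmul (e i) (opUnit ξ (e i))) ξ := by
  have hv := orthonormal_tmul he (f := fun i => opUnit ξ (e i)) fun i => norm_opUnit (h0 i)
  have hin : ∀ i, ‖inner ℂ (tmul (e i) (opUnit ξ (e i))) ξ‖ ^ 2 = ‖op ξ (e i)‖ ^ 2 := by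
    intro i
    rw [norm_inner_symm, ← inner_op, opUnit, inner_smul_right, inner_self_eq_norm_sq_to_K,
      norm_mul, norm_pow, RCLike.norm_ofReal, abs_norm, Complex.norm_real, norm_inv, norm_norm,
      sq ‖op ξ (e i)‖, inv_mul_cancel_left₀ (norm_ne_zero_iff.2 (h0 i)), ← sq]
  have hs : Summable fun i => ‖op ξ (e i)‖ ^ 2 :=
    (hv.inner_products_summable ξ).congr hin
  refine ⟨hs, ?_⟩
  have hsum := (summable_smul_of_orthonormal hv
    (c := fun i => ((‖op ξ (e i)‖ : ℝ) : ℂ)) (by simpa using hs)).hasSum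
  convert hsum using 1
  refine eq_of_op_eq (op_eq_of_orthonormal (e := e) (fun i => ?_) fun x hx => ?_)
  · rw [op_left_of_hasSum he hsum, norm_smul_opUnit (h0 i)]
  · rw [op_eq_zero_of_hasSum hsum hx, hξ x hx]

theorem exists_schmidt_vectors (ξ : HTensor H) :
    ∃ S : Set H, Orthonormal ℂ (Subtype.val : S → H) ∧
      Orthonormal ℂ (fun x : S => opUnit ξ x) ∧ (∀ x : S, op ξ x ≠ 0) ∧
      ∀ x, (∀ s : S, inner ℂ (s : H) x = 0) → op ξ x = 0 := by
  obtain ⟨S, hP, hR, hmax⟩ := exists_maximal_pairwise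
    (fun x : H => ‖x‖ = 1 ∧ opSq ξ x ≠ 0 ∧ ∃ c : ℂ, opSq ξ x = c • x)
    (fun x y => inner ℂ x y = 0)
  have h0 : ∀ x : S, op ξ x ≠ 0 := fun x h => (hP x x.2).2.1 (by rw [opSq_apply, h, map_zero])
  have hort : Orthonormal ℂ (Subtype.val : S → H) :=
    ⟨fun x => (hP x x.2).1, fun x y hxy => hR x.2 y.2 fun h => hxy (Subtype.ext h)⟩
  refine ⟨S, hort, ⟨fun x => norm_opUnit (h0 x), fun x y hxy => ?_⟩, h0, fun x hx => ?_⟩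
  · obtain ⟨c, hc⟩ := (hP y y.2).2.2
    change inner ℂ (opUnit ξ x) (opUnit ξ y) = 0
    rw [opUnit, opUnit, inner_smul_left, inner_smul_right, ← inner_opSq, hc, inner_smul_left,
      hort.2 hxy.symm, mul_zero, mul_zero, mul_zero]
  · have hmem : ∀ z, z ∈ (Submodule.span ℂ S)ᗮ ↔ ∀ s ∈ S, inner ℂ s z = 0 := fun z =>
      mem_orthogonal_span_iff
    by_contra hne
    obtain ⟨y, hyM, hy⟩ := exists_eigenvector_mem (isCompactOperator_opSq ξ) (opSq_isSymmetric ξ)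
      (Submodule.span ℂ S)ᗮ (Submodule.isClosed_orthogonal _) (fun z hz => by
        rw [hmem] at hz ⊢
        intro s hs
        obtain ⟨c, hc⟩ := (hP s hs).2.2
        have h1 := opSq_isSymmetric ξ s z
        change inner ℂ (opSq ξ s) z = inner ℂ s (opSq ξ z) at h1
        rw [← h1, hc, inner_smul_left, hz s hs, mul_zero])
      ((hmem x).2 fun s hs => hx ⟨s, hs⟩) fun h => hne (op_eq_zero_of_opSq_eq_zero h)
    rw [hmem] at hyM
    have hyS := hmax y hy fun s hs => ⟨hyM s hs, inner_eq_zero_symm.1 (hyM s hs)⟩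
    have h2 := inner_self_eq_zero.1 (hyM y hyS)
    rw [h2, norm_zero] at hy
    exact zero_ne_one hy.1

theorem inner_op_antisymm {ξ : HTensor H} (hξ : swap ξ = -ξ) (x y : H) :
    inner ℂ (op ξ x) y = -inner ℂ (op ξ y) x := by
  rw [← inner_op_swap, hξ, op_neg, neg_apply, inner_neg_left]

theorem inner_op_self {ξ : HTensor H} (hξ : swap ξ = -ξ) (x : H) : inner ℂ (op ξ x) x = 0 := by
  have h := inner_op_antisymm hξ x x
  linear_combination (1 / 2 : ℂ) * h

theorem opSq_eq_neg {ξ : HTensor H} (hξ : swap ξ = -ξ) (x : H) :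
    opSq ξ x = -op ξ (op ξ x) := by
  rw [opSq_apply, hξ, op_neg, neg_apply]

/-- Maximality is taken for the relation that also makes `op ξ x` orthogonal to `y`, so that the
planes spanned by `x` and `op ξ x` are mutually orthogonal; skewness gives orthogonality within each
plane. -/
theorem exists_slater_vectors {ξ : HTensor H} (hξ : swap ξ = -ξ) :
    ∃ S : Set H, Orthonormal ℂ (Subtype.val : S → H) ∧
      Orthonormal ℂ (fun x : S => opUnit ξ x) ∧ (∀ x : S, op ξ x ≠ 0) ∧
      (∀ x y : S, inner ℂ (x : H) (opUnit ξ y) = 0) ∧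
      (∀ x : S, op ξ (opUnit ξ x) = -((‖op ξ x‖ : ℝ) : ℂ) • (x : H)) ∧
      ∀ x, (∀ s : S, inner ℂ (s : H) x = 0) → (∀ s : S, inner ℂ (opUnit ξ s) x = 0) →
        op ξ x = 0 := by
  obtain ⟨S, hP, hR, hmax⟩ := exists_maximal_pairwise
    (fun x : H => ‖x‖ = 1 ∧ opSq ξ x ≠ 0 ∧ ∃ c : ℂ, opSq ξ x = c • x)
    (fun x y => inner ℂ x y = 0 ∧ inner ℂ (op ξ x) y = 0)
  have h0 : ∀ x : S, op ξ x ≠ 0 := fun x h => (hP x x.2).2.1 (by rw [opSq_apply, h, map_zero])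
  have hort : Orthonormal ℂ (Subtype.val : S → H) :=
    ⟨fun x => (hP x x.2).1, fun x y hxy => (hR x.2 y.2 fun h => hxy (Subtype.ext h)).1⟩
  refine ⟨S, hort, ⟨fun x => norm_opUnit (h0 x), fun x y hxy => ?_⟩, h0, fun x y => ?_,
    fun x => ?_, fun x hx hx' => ?_⟩
  · obtain ⟨c, hc⟩ := (hP y y.2).2.2
    change inner ℂ (opUnit ξ x) (opUnit ξ y) = 0
    rw [opUnit, opUnit, inner_smul_left, inner_smul_right, ← inner_opSq, hc, inner_smul_left,
      hort.2 hxy.symm, mul_zero, mul_zero, mul_zero]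
  · rw [opUnit, inner_smul_right, inner_eq_zero_symm.1, mul_zero]
    by_cases hxy : y = x
    · rw [hxy, inner_op_self hξ]
    · exact (hR y.2 x.2 fun h => hxy (Subtype.ext h)).2
  · obtain ⟨c, hc⟩ := (hP x x.2).2.2
    have hsq : c = ((‖op ξ x‖ ^ 2 : ℝ) : ℂ) := by
      have h1 := inner_opSq ξ x x
      rw [← inner_conj_symm, ← inner_conj_symm (op ξ x), hc, inner_smul_right,
        inner_self_eq_norm_sq_to_K, hort.1 x, inner_self_eq_norm_sq_to_K] at h1
      have h2 := (starRingEnd ℂ).injective h1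
      simpa using h2
    have hne := norm_ne_zero_iff.2 (h0 x)
    rw [opUnit, map_smulₛₗ, Complex.conj_ofReal, ← neg_neg (op ξ (op ξ x)), ← opSq_eq_neg hξ, hc,
      hsq, smul_neg, smul_smul, ← Complex.ofReal_mul, sq, inv_mul_cancel_left₀ hne, neg_smul]
  · have hmem : ∀ z, z ∈ (Submodule.span ℂ (S ∪ op ξ '' S))ᗮ ↔
        ∀ s ∈ S, inner ℂ s z = 0 ∧ inner ℂ (op ξ s) z = 0 := fun z => by
      rw [mem_orthogonal_span_iff]
      constructor
      · exact fun h s hs => ⟨h s (Or.inl hs), h _ (Or.inr ⟨s, hs, rfl⟩)⟩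
      · rintro h _ (hs | ⟨s, hs, rfl⟩)
        · exact (h _ hs).1
        · exact (h s hs).2
    by_contra hne
    obtain ⟨y, hyM, hy⟩ := exists_eigenvector_mem (isCompactOperator_opSq ξ) (opSq_isSymmetric ξ)
      (Submodule.span ℂ (S ∪ op ξ '' S))ᗮ (Submodule.isClosed_orthogonal _) (fun z hz => by
        rw [hmem] at hz ⊢
        intro s hs
        obtain ⟨c, hc⟩ := (hP s hs).2.2
        have h1 : ∀ w, inner ℂ (opSq ξ w) z = inner ℂ w (opSq ξ z) :=
          fun w => opSq_isSymmetric ξ w z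
        -- `opSq ξ = -(op ξ)²` commutes with `op ξ`, so `op ξ s` is an eigenvector too and the
        -- complement of all the planes is invariant.
        have h2 : opSq ξ (op ξ s) = (starRingEnd ℂ c) • op ξ s := by
          rw [opSq_eq_neg hξ, ← map_neg, ← opSq_eq_neg hξ, hc, map_smulₛₗ]
        rw [← h1, ← h1, hc, h2, inner_smul_left, inner_smul_left, (hz s hs).1, (hz s hs).2,
          mul_zero, mul_zero]
        exact ⟨rfl, rfl⟩)
      ((hmem x).2 fun s hs => ⟨hx ⟨s, hs⟩, by
        rw [← norm_smul_opUnit (h0 ⟨s, hs⟩), inner_smul_left, hx' ⟨s, hs⟩, mul_zero]⟩)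
      fun h => hne (op_eq_zero_of_opSq_eq_zero h)
    rw [hmem] at hyM
    have hyS := hmax y hy fun s hs => ⟨hyM s hs, inner_eq_zero_symm.1 (hyM s hs).1, by
      rw [inner_op_antisymm hξ, (hyM s hs).2, neg_zero]⟩
    have h2 := inner_self_eq_zero.1 (hyM y hyS).1
    rw [h2, norm_zero] at hy
    exact zero_ne_one hy.1

end Existence

/-! ### Padding to sequences and assembling the decompositions -/

section Sequences

variable {H : Type*} [NormedAddCommGroup H] [InnerProductSpace ℂ H]

theorem exists_orthonormal_seq_orthogonal (hH : ¬ FiniteDimensional ℂ H) (W : Submodule ℂ H)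
    [FiniteDimensional ℂ W] :
    ∃ w : ℕ → H, Orthonormal ℂ w ∧ ∀ x ∈ W, ∀ n, inner ℂ x (w n) = 0 := by
  have hinf : ¬ FiniteDimensional ℂ Wᗮ := fun h => by
    refine hH (Module.finite_def.2 ?_)
    rw [← Submodule.sup_orthogonal_of_hasOrthogonalProjection (K := W)]
    exact (Submodule.fg_iff_finiteDimensional W |>.2 inferInstance).sup
      (Submodule.fg_iff_finiteDimensional Wᗮ |>.2 h)
  let b := Module.Basis.ofVectorSpace ℂ Wᗮ
  have hb : Infinite (Module.Basis.ofVectorSpaceIndex ℂ Wᗮ) := by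
    by_contra h
    have := not_infinite_iff_finite.1 h
    exact hinf (Module.Finite.of_basis b)
  have hli := b.linearIndependent.comp _ (Infinite.natEmbedding _).injective
  have ho := InnerProductSpace.gramSchmidtNormed_orthonormal (𝕜 := ℂ) hli
  exact ⟨_, ho.comp_linearIsometry Wᗮ.subtypeₗᵢ, fun x hx n => (Submodule.coe_mem _ : _ ∈ Wᗮ) x hx⟩

/-- A pair of countable families in an infinite-dimensional space is extended by two mutually
orthogonal orthonormal families to a pair of sequences. -/
theorem exists_orthonormal_extension (hH : ¬ FiniteDimensional ℂ H) {ι : Type*} [Countable ι]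
    (e f : ι → H) :
    ∃ (κ : Type) (_ : ℕ ≃ ι ⊕ κ) (u v : κ → H), Orthonormal ℂ u ∧ Orthonormal ℂ v ∧
      (∀ k l, inner ℂ (u k) (v l) = 0) ∧ (∀ i k, inner ℂ (e i) (u k) = 0) ∧
      (∀ i k, inner ℂ (e i) (v k) = 0) ∧ (∀ i k, inner ℂ (f i) (u k) = 0) ∧
      (∀ i k, inner ℂ (f i) (v k) = 0) := by
  rcases finite_or_infinite ι with hι | hι
  · have := FiniteDimensional.span_of_finite ℂ (Set.finite_range (Sum.elim e f))
    obtain ⟨w, hw, hWw⟩ := exists_orthonormal_seq_orthogonal hH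
      (Submodule.span ℂ (Set.range (Sum.elim e f)))
    have hew := fun i n => hWw (e i) (Submodule.subset_span ⟨Sum.inl i, rfl⟩) n
    have hfw := fun i n => hWw (f i) (Submodule.subset_span ⟨Sum.inr i, rfl⟩) n
    obtain ⟨φ⟩ := nonempty_denumerable (ι ⊕ ℕ)
    -- Even and odd terms of one orthonormal sequence give two mutually orthogonal ones.
    exact ⟨ℕ, (Denumerable.eqv (ι ⊕ ℕ)).symm, fun n => w (2 * n), fun n => w (2 * n + 1),
      hw.comp _ fun a b h => by simpa using h, hw.comp _ fun a b h => by simpa using h,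
      fun k l => hw.2 (by omega), fun i k => hew i _, fun i k => hew i _, fun i k => hfw i _,
      fun i k => hfw i _⟩
  · obtain ⟨φ⟩ := nonempty_denumerable ι
    -- A countably infinite family is already a sequence, so nothing is added; its span might leave
    -- no room anyway.
    refine ⟨Empty, (Denumerable.eqv ι).symm.trans (Equiv.sumEmpty ι Empty).symm, Empty.elim,
      Empty.elim, ⟨fun k => k.elim, fun k => k.elim⟩, ⟨fun k => k.elim, fun k => k.elim⟩,
      fun k => k.elim, fun _ k => k.elim, fun _ k => k.elim, fun _ k => k.elim,
      fun _ k => k.elim⟩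

theorem memℓp_sumElim_zero_comp {ι κ : Type*} {lam : ι → ℝ} (hs : Summable fun i => lam i ^ 2)
    (φ : ℕ ≃ ι ⊕ κ) : Memℓp (Sum.elim lam (0 : κ → ℝ) ∘ φ) 2 := by
  refine memℓp_gen ?_
  have h1 : Summable fun i : ι ⊕ κ => Sum.elim lam (0 : κ → ℝ) i ^ 2 :=
    Summable.sum _ hs (by simp [Function.comp_def])
  simpa [Function.comp_def] using φ.summable_iff.2 h1

theorem hasSum_sumElim_zero_comp {ι κ : Type*} {lam : ι → ℝ} {ξ : HTensor H}
    {η : ι ⊕ κ → HTensor H} (hs : HasSum (fun i => (lam i : ℂ) • η (Sum.inl i)) ξ)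
    (φ : ℕ ≃ ι ⊕ κ) :
    HasSum (fun n => ((Sum.elim lam (0 : κ → ℝ) (φ n) : ℝ) : ℂ) • η (φ n)) ξ := by
  have h1 : HasSum (fun i => ((Sum.elim lam (0 : κ → ℝ) i : ℝ) : ℂ) • η i) (ξ + 0) :=
    HasSum.sum hs (by simp [Function.comp_def])
  rw [add_zero] at h1
  exact φ.hasSum_iff.2 h1

theorem sumElim_zero_nonneg {ι κ : Type*} {lam : ι → ℝ} (h : ∀ i, 0 ≤ lam i) (i : ι ⊕ κ) :
    0 ≤ Sum.elim lam (0 : κ → ℝ) i := by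
  rcases i with i | k
  · exact h i
  · exact le_rfl

theorem countable_of_summable_sq {ι : Type*} {lam : ι → ℝ} (h0 : ∀ i, lam i ≠ 0)
    (hs : Summable fun i => lam i ^ 2) : Countable ι := by
  have h1 := hs.countable_support
  have h2 : Function.support (fun i => lam i ^ 2) = Set.univ := by
    ext i
    simp [h0 i]
  rw [h2] at h1
  exact Set.countable_univ_iff.1 h1

/-- A Slater expansion with nonzero coefficients over an arbitrary index type extends to a Slater
decomposition. -/
theorem exists_isSlaterDecomposition_of_hasSum (hH : ¬ FiniteDimensional ℂ H) {ι : Type*}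
    {e f : ι → H} {c : ι → ℝ} {ξ : HTensor H} (he : Orthonormal ℂ e) (hf : Orthonormal ℂ f)
    (hef : ∀ i j, inner ℂ (e i) (f j) = 0) (hc : ∀ i, 0 < c i) (hsq : Summable fun i => c i ^ 2)
    (hs : HasSum (fun i => (c i : ℂ) • wedge (e i) (f i)) ξ) :
    ∃ (lam : ℕ → ℝ) (e f : ℕ → H), IsSlaterDecomposition ξ lam e f := by
  have := countable_of_summable_sq (fun i => (hc i).ne') hsq
  obtain ⟨κ, φ, u, v, hu, hv, huv, heu, hev, hfu, hfv⟩ := exists_orthonormal_extension hH e f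
  refine ⟨Sum.elim c 0 ∘ φ, Sum.elim e u ∘ φ, Sum.elim f v ∘ φ,
    fun n => sumElim_zero_nonneg (fun i => (hc i).le) _, memℓp_sumElim_zero_comp hsq φ,
    (orthonormal_sumElim he hu heu).comp _ φ.injective,
    (orthonormal_sumElim hf hv hfv).comp _ φ.injective, fun m n => ?_,
    hasSum_sumElim_zero_comp (η := fun i => wedge (Sum.elim e u i) (Sum.elim f v i)) hs φ⟩
  rw [Function.comp_apply, Function.comp_apply]
  rcases φ m with i | k <;> rcases φ n with j | l
  · exact hef i j
  · exact hev i l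
  · exact inner_eq_zero_symm.1 (hfu j k)
  · exact huv k l

variable [CompleteSpace H]

theorem exists_isSchmidtDecomposition (hH : ¬ FiniteDimensional ℂ H) (ξ : HTensor H) :
    ∃ (lam : ℕ → ℝ) (e f : ℕ → H), IsSchmidtDecomposition ξ lam e f := by
  obtain ⟨S, he, hf, h0, hξ⟩ := exists_schmidt_vectors ξ
  obtain ⟨hsq, hsum⟩ := summable_and_hasSum_of_orthonormal he h0 hξ
  have := countable_of_summable_sq (fun i => norm_ne_zero_iff.2 (h0 i)) hsq
  obtain ⟨κ, φ, u, v, hu, hv, -, heu, -, -, hfv⟩ :=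
    exists_orthonormal_extension hH (Subtype.val : S → H) (fun x : S => opUnit ξ x)
  exact ⟨Sum.elim (fun x : S => ‖op ξ x‖) 0 ∘ φ, Sum.elim Subtype.val u ∘ φ,
    Sum.elim (fun x : S => opUnit ξ x) v ∘ φ, fun n => sumElim_zero_nonneg (by simp) _,
    memℓp_sumElim_zero_comp hsq φ, (orthonormal_sumElim he hu heu).comp _ φ.injective,
    (orthonormal_sumElim hf hv hfv).comp _ φ.injective,
    hasSum_sumElim_zero_comp (η := fun i => tmul (Sum.elim Subtype.val u i)
      (Sum.elim (fun x : S => opUnit ξ x) v i)) hsum φ⟩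

/-- The Schmidt expansion is applied to the joint family of the `e i` and `f i`, whose normalized
images are `f i` and `-e i`; the two terms with index `i` then combine into one wedge, with factor
`√2`. -/
theorem summable_and_hasSum_wedge {ι : Type*} {e f : ι → H} {c : ι → ℝ} {ξ : HTensor H}
    (he : Orthonormal ℂ e) (hf : Orthonormal ℂ f) (hef : ∀ i j, inner ℂ (e i) (f j) = 0)
    (hc : ∀ i, 0 < c i) (hξe : ∀ i, op ξ (e i) = (c i : ℂ) • f i)
    (hξf : ∀ i, op ξ (f i) = -(c i : ℂ) • e i)
    (hξ : ∀ x, (∀ i, inner ℂ (e i) x = 0) → (∀ i, inner ℂ (f i) x = 0) → op ξ x = 0) :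
    (Summable fun i => (Real.sqrt 2 * c i) ^ 2) ∧
      HasSum (fun i => ((Real.sqrt 2 * c i : ℝ) : ℂ) • wedge (e i) (f i)) ξ := by
  have hc0 : ∀ i, (c i : ℂ) ≠ 0 := fun i => by exact_mod_cast (hc i).ne'
  have hne : ∀ i, ‖op ξ (e i)‖ = c i := fun i => by
    rw [hξe, norm_smul, Complex.norm_real, hf.1, mul_one, Real.norm_of_nonneg (hc i).le]
  have hnf : ∀ i, ‖op ξ (f i)‖ = c i := fun i => by
    rw [hξf, norm_smul, norm_neg, Complex.norm_real, he.1, mul_one, Real.norm_of_nonneg (hc i).le]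
  have hue : ∀ i, opUnit ξ (e i) = f i := fun i => by
    rw [opUnit, hne, hξe, smul_smul, Complex.ofReal_inv, inv_mul_cancel₀ (hc0 i), one_smul]
  have huf : ∀ i, opUnit ξ (f i) = -e i := fun i => by
    rw [opUnit, hnf, hξf, neg_smul, smul_neg, smul_smul, Complex.ofReal_inv,
      inv_mul_cancel₀ (hc0 i), one_smul]
  obtain ⟨hsq, hsum⟩ := summable_and_hasSum_of_orthonormal (orthonormal_sumElim he hf hef)
    (ξ := ξ) (Sum.rec (fun i => norm_ne_zero_iff.1 ((hne i).trans_ne (hc i).ne'))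
      fun i => norm_ne_zero_iff.1 ((hnf i).trans_ne (hc i).ne'))
    (fun x hx => hξ x (fun i => hx (Sum.inl i)) fun i => hx (Sum.inr i))
  have hsq' : Summable fun i => c i ^ 2 :=
    (hsq.comp_injective Sum.inl_injective).congr fun i => by
      rw [Function.comp_apply, Sum.elim_inl, hne]
  refine ⟨by simpa only [mul_pow] using hsq'.mul_left (Real.sqrt 2 ^ 2), ?_⟩
  have h1 := (hsum.summable.comp_injective Sum.inl_injective).hasSum
  have h2 := (hsum.summable.comp_injective Sum.inr_injective).hasSum
  have hadd := h1.add h2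
  rw [← hsum.unique (HasSum.sum h1 h2)] at hadd
  refine hadd.congr_fun fun i => ?_
  have h22 : Real.sqrt 2 * c i * (Real.sqrt 2)⁻¹ = c i := by
    rw [mul_right_comm, mul_inv_cancel₀ (by positivity), one_mul]
  rw [Function.comp_apply, Function.comp_apply, Sum.elim_inl, Sum.elim_inr, hne, hnf, hue, huf,
    tmul_neg_right, ← smul_add, ← sub_eq_add_neg, wedge_eq, smul_smul, ← Complex.ofReal_mul, h22]

theorem exists_isSlaterDecomposition (hH : ¬ FiniteDimensional ℂ H) {ξ : HTensor H}
    (hξ : ξ ∈ fermionic H) :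
    ∃ (lam : ℕ → ℝ) (e f : ℕ → H), IsSlaterDecomposition ξ lam e f := by
  obtain ⟨S, he, hf, h0, hef, hop, hker⟩ :=
    exists_slater_vectors (swap_eq_neg_of_mem_fermionic hξ)
  obtain ⟨hsq, hsum⟩ := summable_and_hasSum_wedge he hf hef (fun x => norm_pos_iff.2 (h0 x))
    (fun x => (norm_smul_opUnit (h0 x)).symm) hop hker
  exact exists_isSlaterDecomposition_of_hasSum hH he hf hef
    (fun x => mul_pos (by positivity) (norm_pos_iff.2 (h0 x))) hsq hsum

end Sequences

end BipartiteHilbert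

theorem mainTheorem7 {H : Type*} [NormedAddCommGroup H] [InnerProductSpace ℂ H] [CompleteSpace H]
    (hH : ¬ FiniteDimensional ℂ H) :
    (∀ ξ : BipartiteHilbert.HTensor H,
      (∃ (lam : ℕ → ℝ) (e f : ℕ → H),
        BipartiteHilbert.IsSchmidtDecomposition ξ lam e f) ∧
      (∀ (lam mu : ℕ → ℝ) (e f e' f' : ℕ → H),
        BipartiteHilbert.IsSchmidtDecomposition ξ lam e f →
        BipartiteHilbert.IsSchmidtDecomposition ξ mu e' f' →
        BipartiteHilbert.SameNonzeroTerms lam mu) ∧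
      (∀ (lam : ℕ → ℝ) (e f : ℕ → H),
        BipartiteHilbert.IsSchmidtDecomposition ξ lam e f →
        {n : ℕ | lam n ≠ 0}.encard = BipartiteHilbert.schmidtRank ξ)) ∧
    (∀ ξ ∈ BipartiteHilbert.fermionic H,
      (∃ (lam : ℕ → ℝ) (e f : ℕ → H),
        BipartiteHilbert.IsSlaterDecomposition ξ lam e f) ∧
      (∀ (lam mu : ℕ → ℝ) (e f e' f' : ℕ → H),
        BipartiteHilbert.IsSlaterDecomposition ξ lam e f →
        BipartiteHilbert.IsSlaterDecomposition ξ mu e' f' →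
        BipartiteHilbert.SameNonzeroTerms lam mu) ∧
      (∀ (lam : ℕ → ℝ) (e f : ℕ → H),
        BipartiteHilbert.IsSlaterDecomposition ξ lam e f →
        {n : ℕ | lam n ≠ 0}.encard = BipartiteHilbert.slaterRank ξ)) := by

  refine ⟨fun ξ => ⟨BipartiteHilbert.exists_isSchmidtDecomposition hH ξ,
    fun _ _ _ _ _ _ h h' => h.sameNonzeroTerms h', fun _ _ _ h => h.encard_eq⟩,
    fun ξ hξ => ⟨BipartiteHilbert.exists_isSlaterDecomposition hH hξ,
    fun _ _ _ _ _ _ h h' => h.sameNonzeroTerms h', fun _ _ _ h => h.encard_eq⟩⟩
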